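/- Let $\varphi\colon[-1,1]\to\mathbb R$ be Lebesgue measurable with $$0<\varphi_{\min}=\inf_{x\in[-1,1]}|\varphi(x)|\le\varphi_{\max}=\sup_{x\in[-1,1]}|\varphi(x)|<\infty ,$$ let $(\alpha_k)_{k\ge0}$ be a sequence of positive reals with $\sum_{k\ge0}\alpha_k^{-1}<\infty$, and let $\lambda>0$ be such that $$\frac{\alpha_k}{\alpha_n}\le\lambda^{n-k}\frac{k!}{n!}\qquad\text{for all }n\ge0\text{ and }0\le k\le n .$$ Let $H(K)$, with norm $\|\cdot\|_K$, be the real reproducing kernel Hilbert space on $[-1,1]$ of the kernel $$K(x,y)=\varphi(x)\varphi(y)\sum_{k=0}^\infty\alpha_k^{-1}x^ky^k .$$ For $n\in\mathbb N$ consider all linear approximations of the form $A_nf=\sum_{k=1}^nf(x_k)\psi_k$, where $x_1,\dots,x_n\in[-1,1]$ are pairwise distinct points and $\psi_1,\dots,\psi_n\colon[-1,1]\to\mathbb R$ are Lebesgue measurable functions, and define $$e_2(A_n)=\sup_{0\ne f\in H(K)}\frac{\bigl(\int_{-1}^1|f(x)-(A_nf)(x)|^2\,dx\bigr)^{1/2}}{\|f\|_K}\in[0,\infty],\qquad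 e_2^{\min}(n)=\inf_{A_n}e_2(A_n),$$ the infimum being over all such approximations. Put $$c_L(\lambda)=\frac{e^{-\frac32\lambda+2\sqrt\lambda}}{2\sqrt\pi\,\lambda^{1/4}}\Bigl(3+\sqrt{\tfrac{\pi}{e}}+\frac{2}{\sqrt\pi\,\lambda^{1/4}}+\frac{7}{16\sqrt\lambda}+\sqrt\lambda\,(2+\lambda)\Bigr),$$ $$m_L(\lambda)=\max\Bigl\{5\lambda,\ \lambda\bigl(1+\tfrac\lambda2\bigr)^2,\ \tfrac9\lambda\Bigr\},$$ $$c_{1,2}=\frac{2\sqrt{2\pi}}{3e^3\sqrt{4+\lambda}}\,e^{-\frac1{32}\lambda^2}\varphi_{\min},\qquad c_{2,2}=2\sqrt{2c_L(\lambda)}\,\varphi_{\max}.$$ Then for every $n\in\mathbb N$ with $n\ge m_L(\lambda)$, $$c_{1,2}\,2^{-n}\alpha_n^{-1/2}\ \le\ e_2^{\min}(n)\ \le\ c_{2,2}\,n^{-1/8}e^{\sqrt{\lambda n}}\,2^{-n}\alpha_n^{-1/2}.$$ -/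

import Mathlib

open MeasureTheory
open scoped ENNReal

noncomputable section

namespace PowerSeriesKernel

/-- The interval `[-1, 1]`, on which all functions live. -/
abbrev Interval : Type := Set.Icc (-1 : ℝ) 1

/-- Lebesgue measure on `[-1, 1]`. A function `f` on `[-1, 1]` is Lebesgue measurable precisely
when `NullMeasurable f lebesgue`. -/
def lebesgue : Measure Interval := Measure.comap Subtype.val volume

/-- The weighted power series kernel `K(x, y) = φ(x) φ(y) ∑ₖ αₖ⁻¹ xᵏ yᵏ`. -/
def kernel (φ : Interval → ℝ) (α : ℕ → ℝ) (x y : Interval) : ℝ :=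
  φ x * φ y * ∑' k : ℕ, (α k)⁻¹ * (x : ℝ) ^ k * (y : ℝ) ^ k

/-- `H` is the reproducing kernel Hilbert space of the scalar kernel `K`. -/
def IsRKHSOf (H : Type*) [NormedAddCommGroup H] [InnerProductSpace ℝ H] [CompleteSpace H]
    {X : Type*} [RKHS ℝ H X ℝ] (K : X → X → ℝ) : Prop :=
  ∀ x y : X, RKHS.kernel H x y 1 = K x y

/-- `φ_min = inf |φ|` over `[-1, 1]`. -/
def phiMin (φ : Interval → ℝ) : ℝ := ⨅ x, |φ x|

/-- `φ_max = sup |φ|` over `[-1, 1]` (used only for bounded `φ`). -/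
def phiMax (φ : Interval → ℝ) : ℝ := ⨆ x, |φ x|

/-- The data of a linear approximation `f ↦ ∑ₖ f(xₖ) ψₖ` from `n` function evaluations: pairwise
distinct points `xₖ ∈ [-1, 1]` and Lebesgue measurable functions `ψₖ` on `[-1, 1]`. -/
structure LinearApprox (n : ℕ) where
  point : Fin n → Interval
  point_injective : Function.Injective point
  weight : Fin n → Interval → ℝ
  weight_measurable : ∀ k, NullMeasurable (weight k) lebesgue

/-- `(A f)(x) = ∑ₖ f(xₖ) ψₖ(x)`. -/
def LinearApprox.apply {n : ℕ} (A : LinearApprox n) (f : Interval → ℝ) : Interval → ℝ :=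
  fun x => ∑ k, f (A.point k) * A.weight k x

/-- The worst-case error `e₂(A) = sup_{0 ≠ f ∈ H} ‖f - A f‖₂ / ‖f‖_H`, possibly infinite. -/
def worstCaseError (H : Type*) [NormedAddCommGroup H] [InnerProductSpace ℝ H]
    [RKHS ℝ H Interval ℝ] {n : ℕ} (A : LinearApprox n) : ℝ≥0∞ :=
  ⨆ (f : H) (_ : f ≠ 0), eLpNorm (fun x => f x - A.apply f x) 2 lebesgue / ‖f‖ₑ

/-- The `n`-th minimal error `e₂^min(n) = inf_A e₂(A)`. -/
def minimalError (H : Type*) [NormedAddCommGroup H] [InnerProductSpace ℝ H]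
    [RKHS ℝ H Interval ℝ] (n : ℕ) : ℝ≥0∞ :=
  ⨅ A : LinearApprox n, worstCaseError H A

/-- The function `c_L`. -/
def cL (l : ℝ) : ℝ :=
  Real.exp (-(3 / 2) * l + 2 * √l) / (2 * √Real.pi * l ^ (1 / 4 : ℝ)) *
    (3 + √(Real.pi / Real.exp 1) + 2 / (√Real.pi * l ^ (1 / 4 : ℝ)) + 7 / (16 * √l)
      + √l * (2 + l))

/-- The function `m_L`. -/
def mL (l : ℝ) : ℝ :=
  max (5 * l) (max (l * (1 + l / 2) ^ 2) (9 / l))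

/-- The constant `c_{1,2}`. -/
def cLower (l : ℝ) (φ : Interval → ℝ) : ℝ :=
  2 * √(2 * Real.pi) / (3 * Real.exp 3 * √(4 + l)) * Real.exp (-(1 / 32) * l ^ 2) * phiMin φ

/-- The constant `c_{2,2}`. -/
def cUpper (l : ℝ) (φ : Interval → ℝ) : ℝ :=
  2 * √(2 * cL l) * phiMax φ

/-- The reproducing kernel Hilbert space of the weighted power series kernel exists. -/
theorem exists_isRKHSOf_kernel (φ : Interval → ℝ) (α : ℕ → ℝ) (hα : ∀ k, 0 < α k)
    (hsum : Summable fun k => (α k)⁻¹) :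
    ∃ (H : Type) (_ : NormedAddCommGroup H) (_ : InnerProductSpace ℝ H) (_ : CompleteSpace H)
      (_ : RKHS ℝ H Interval ℝ), IsRKHSOf H (kernel φ α) := by
  have hs : ∀ x y : Interval, Summable fun k : ℕ => (α k)⁻¹ * (x : ℝ) ^ k * (y : ℝ) ^ k := by
    intro x y
    refine Summable.of_norm_bounded hsum fun k => ?_
    have hx : |(x : ℝ)| ^ k ≤ 1 := pow_le_one₀ (abs_nonneg _) (abs_le.2 x.2)
    have hy : |(y : ℝ)| ^ k ≤ 1 := pow_le_one₀ (abs_nonneg _) (abs_le.2 y.2)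
    have h0 := (inv_pos.2 (hα k)).le
    rw [Real.norm_eq_abs, abs_mul, abs_mul, abs_of_nonneg h0, abs_pow, abs_pow, mul_assoc]
    exact mul_le_of_le_one_right h0 (mul_le_one₀ hx (by positivity) hy)
  let M : Matrix Interval Interval (ℝ →L[ℝ] ℝ) :=
    .of fun x y => kernel φ α x y • ContinuousLinearMap.id ℝ ℝ
  have hM : M.PosSemidef := by
    have tfae := RKHS.posSemidef_tfae (𝕜 := ℝ) (K := M)
    have h02 := tfae.out 0 2
    rw [h02]
    refine ⟨?_, fun v => ?_⟩
    · ext x y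
      simp [M, Matrix.conjTranspose_apply, ContinuousLinearMap.star_eq_adjoint, kernel, mul_comm,
        mul_left_comm, ContinuousLinearMap.adjoint_id]
    · have key : (v.sum fun x w => v.sum fun x' w' => inner ℝ (M x' x w) w')
          = ∑' k : ℕ, (α k)⁻¹ * (v.sum fun x w => w * φ x * (x : ℝ) ^ k) ^ 2 := by
        simp only [Finsupp.sum]
        have h1 : ∀ x ∈ v.support, ∀ x' ∈ v.support, inner ℝ (M x' x (v x)) (v x')
            = ∑' k : ℕ, (v x * φ x * (v x' * φ x')) *
              ((α k)⁻¹ * (x' : ℝ) ^ k * (x : ℝ) ^ k) := by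
          intro x _ x' _
          rw [tsum_mul_left]
          simp [M, kernel]
          ring
        rw [Finset.sum_congr rfl fun x hx => Finset.sum_congr rfl (h1 x hx)]
        rw [Finset.sum_congr rfl fun x _ => (Summable.tsum_finsetSum
          fun x' _ => (hs x' x).mul_left _).symm]
        rw [← Summable.tsum_finsetSum
          fun x _ => summable_sum fun x' _ => (hs x' x).mul_left _]
        refine tsum_congr fun k => ?_
        rw [sq, Finset.sum_mul_sum, Finset.mul_sum]
        refine Finset.sum_congr rfl fun x _ => ?_
        rw [Finset.mul_sum]
        exact Finset.sum_congr rfl fun x' _ => by ring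
      rw [key]
      exact tsum_nonneg fun k => mul_nonneg (inv_pos.2 (hα k)).le (sq_nonneg _)
  have : Fact M.PosSemidef := ⟨hM⟩
  refine ⟨RKHS.OfKernel M, inferInstance, inferInstance, inferInstance, inferInstance, ?_⟩
  intro x y
  rw [RKHS.OfKernel.kernel_ofKernel]
  simp [M]

end PowerSeriesKernel

end

/-! ### The space as an isometric image in `ℓ²`: Taylor coefficients and error functionals -/

noncomputable section

namespace PowerSeriesKernel

/-! The kernel is the Gram kernel of the vectors `(φ(x) xᵏ / √αₖ)ₖ` in `ℓ²`. Hence `φ·p` with `p` a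
polynomial has squared norm at most `∑ αₖ pₖ²` (`exists_eq_polynomial`), and error functionals have
computable norms (`sq_apply_sub_sum_le`).

Lower bound: if `p` is the nodal polynomial of the points, every rule sends `f = φ·p` to zero, so
the error is at least `‖f‖₂ / ‖f‖`. It remains to bound `∑ αₖ pₖ²` by a multiple of `4ⁿ αₙ ‖p‖₂²`,
which holds for every `p` of degree at most `n` (`sum_mul_sq_coeff_le_integral`,
`sum_four_pow_mul_le`). Expand `p` in the Chebyshev polynomials `Uⱼ`: they are orthogonal for the
weight `√(1 - x²) ≤ 1`, which controls the coordinates by `‖p‖₂`. The explicit coefficients of `Uⱼ`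
and the growth of `α` give `Uⱼ` a weighted norm of order `4ʲ αⱼ`, and these sum geometrically.

Upper bound: interpolate `f/φ` at the zeros of `Tₙ` and multiply by `φ`. The squared error at a
point is at most `‖f‖² φ(x)² ∑ αₖ⁻¹ Eₖ(x)²`, where `Eₖ` is the interpolation error of `xᵏ`. It
vanishes for `k < n`; beyond that, aliasing bounds the error of every `Tₖ` by `2`, and a Chernoff
estimate for the expansion of `xᵏ` in Chebyshev polynomials (`abs_interpError_X_pow_le`) gives the
factor `4⁻ⁿ`. The outcome `41 e^λ φ_max² 4⁻ⁿ αₙ⁻¹` lies below the claimed bound by `exp_mul_le_cL`.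
-/

lemma summable_kernel_terms {α : ℕ → ℝ} (hα : ∀ k, 0 < α k) (hsum : Summable fun k => (α k)⁻¹)
    (x y : Interval) : Summable fun k : ℕ => (α k)⁻¹ * (x : ℝ) ^ k * (y : ℝ) ^ k := by
  refine Summable.of_norm_bounded hsum fun k => ?_
  have hx : |(x : ℝ)| ^ k ≤ 1 := pow_le_one₀ (abs_nonneg _) (abs_le.2 x.2)
  have hy : |(y : ℝ)| ^ k ≤ 1 := pow_le_one₀ (abs_nonneg _) (abs_le.2 y.2)
  have h0 := (inv_pos.2 (hα k)).le
  rw [Real.norm_eq_abs, abs_mul, abs_mul, abs_of_nonneg h0, abs_pow, abs_pow, mul_assoc]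
  exact mul_le_of_le_one_right h0 (mul_le_one₀ hx (by positivity) hy)

/-- The feature vector `(φ(x) xᵏ / √αₖ)ₖ` in `ℓ²`. -/
def feature (φ : Interval → ℝ) {α : ℕ → ℝ} (hα : ∀ k, 0 < α k)
    (hsum : Summable fun k => (α k)⁻¹) (x : Interval) : lp (fun _ : ℕ => ℝ) 2 :=
  ⟨fun k => (√(α k))⁻¹ * (φ x * (x : ℝ) ^ k), by
    refine memℓp_gen ?_
    have := (summable_kernel_terms hα hsum x x).mul_left (φ x ^ 2)
    refine this.congr fun k => ?_
    have h := Real.sq_sqrt (hα k).le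
    simp only [Real.norm_eq_abs, ENNReal.toReal_ofNat, Real.rpow_two, sq_abs, mul_pow, inv_pow, h]
    ring⟩

variable {φ : Interval → ℝ} {α : ℕ → ℝ} (hα : ∀ k, 0 < α k) (hsum : Summable fun k => (α k)⁻¹)

lemma feature_apply (x : Interval) (k : ℕ) :
    feature φ hα hsum x k = (√(α k))⁻¹ * (φ x * (x : ℝ) ^ k) := rfl

lemma inner_feature (x y : Interval) :
    inner ℝ (feature φ hα hsum x) (feature φ hα hsum y) = kernel φ α x y := by
  rw [lp.inner_eq_tsum, kernel, ← tsum_mul_left]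
  refine tsum_congr fun k => ?_
  have h : (α k)⁻¹ = (√(α k))⁻¹ * (√(α k))⁻¹ := by
    rw [← mul_inv, Real.mul_self_sqrt (hα k).le]
  simp only [feature_apply, h, RCLike.inner_apply, conj_trivial]
  ring

variable {H : Type*} [NormedAddCommGroup H] [InnerProductSpace ℝ H] [CompleteSpace H]
  [RKHS ℝ H Interval ℝ]

lemma inner_kerFun_kerFun (hH : IsRKHSOf H (kernel φ α)) (x y : Interval) :
    inner ℝ (RKHS.kerFun H x (1 : ℝ)) (RKHS.kerFun H y (1 : ℝ)) = kernel φ α x y := by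
  rw [RKHS.kerFun_inner, RKHS.kerFun_apply, hH x y]
  simp

/-- Linear combinations of kernel functions have the norm of the corresponding linear combination
of feature vectors. -/
lemma norm_sum_feature (hH : IsRKHSOf H (kernel φ α)) (c : Interval →₀ ℝ) :
    ‖Finsupp.linearCombination ℝ (feature φ hα hsum) c‖ =
      ‖Finsupp.linearCombination ℝ (fun x => RKHS.kerFun H x (1 : ℝ)) c‖ := by
  rw [← sq_eq_sq₀ (norm_nonneg _) (norm_nonneg _), ← real_inner_self_eq_norm_sq,
    ← real_inner_self_eq_norm_sq, Finsupp.linearCombination_apply, Finsupp.linearCombination_apply]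
  simp only [Finsupp.sum_inner, Finsupp.inner_sum, inner_smul_left, inner_smul_right,
    inner_feature, inner_kerFun_kerFun hH]

lemma denseRange_kerFun :
    DenseRange (Finsupp.linearCombination ℝ (fun x : Interval => RKHS.kerFun H x (1 : ℝ))) := by
  have h := RKHS.kerFun_dense (𝕜 := ℝ) (X := Interval) (V := ℝ) H
  have h2 : Submodule.span ℝ {RKHS.kerFun H x v | (x : Interval) (v : ℝ)} ≤
      LinearMap.range (Finsupp.linearCombination ℝ
        (fun x : Interval => RKHS.kerFun H x (1 : ℝ))) := by
    rw [Submodule.span_le]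
    rintro _ ⟨x, v, rfl⟩
    refine ⟨Finsupp.single x v, ?_⟩
    rw [Finsupp.linearCombination_single, ← map_smul]
    simp
  have h3 := Submodule.topologicalClosure_mono h2
  rw [h, top_le_iff] at h3
  intro y
  have : y ∈ (LinearMap.range (Finsupp.linearCombination ℝ
        (fun x : Interval => RKHS.kerFun H x (1 : ℝ)))).topologicalClosure := by
    rw [h3]; trivial
  rwa [← SetLike.mem_coe, Submodule.topologicalClosure_coe, LinearMap.coe_range] at this

/-- Every square-summable coefficient sequence defines an element of the space. -/
lemma exists_eq_inner_feature (hH : IsRKHSOf H (kernel φ α)) (a : lp (fun _ : ℕ => ℝ) 2) :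
    ∃ f : H, (∀ x, f x = inner ℝ (feature φ hα hsum x) a) ∧ ‖f‖ ≤ ‖a‖ := by
  set e := Finsupp.linearCombination ℝ (fun x : Interval => RKHS.kerFun H x (1 : ℝ)) with he
  set g := Finsupp.linearCombination ℝ (feature φ hα hsum) with hg
  have hn : ∀ c, ‖g c‖ ≤ 1 * ‖e c‖ := fun c => by
    rw [one_mul, hg, norm_sum_feature hα hsum hH c]
  have hd : DenseRange e := denseRange_kerFun
  -- The map from kernel functions to features preserves norms, so it extends by density to `V : H →
  -- ℓ²`. The function sought is `V* a`, whose value at `x` is its inner product with the kernel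
  -- function at `x`.
  let V := g.extendOfNorm e
  have hV : ‖V‖ ≤ 1 := g.opNorm_extendOfNorm_le hd zero_le_one hn
  refine ⟨V.adjoint a, fun x => ?_, ?_⟩
  · have h1 : V (RKHS.kerFun H x (1 : ℝ)) = feature φ hα hsum x := by
      have := g.extendOfNorm_eq hd ⟨1, hn⟩ (Finsupp.single x 1)
      simpa [he, hg] using this
    have h2 : inner ℝ (RKHS.kerFun H x (1 : ℝ)) (V.adjoint a) = (V.adjoint a) x := by
      rw [RKHS.kerFun_inner]; simp
    rw [← h2, ContinuousLinearMap.adjoint_inner_right, h1]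
  · calc ‖V.adjoint a‖ ≤ ‖V.adjoint‖ * ‖a‖ := ContinuousLinearMap.le_opNorm _ _
      _ ≤ 1 * ‖a‖ := by
        gcongr
        rw [LinearIsometryEquiv.norm_map]
        exact hV
      _ = ‖a‖ := one_mul _

/-- Weighted polynomials belong to the space. -/
lemma exists_eq_polynomial (hα : ∀ k, 0 < α k) (hsum : Summable fun k => (α k)⁻¹)
    (hH : IsRKHSOf H (kernel φ α)) (p : Polynomial ℝ) :
    ∃ f : H, (∀ x : Interval, f x = φ x * p.eval (x : ℝ)) ∧
      ‖f‖ ^ 2 ≤ ∑ k ∈ Finset.range (p.natDegree + 1), α k * p.coeff k ^ 2 := by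
  let a : lp (fun _ : ℕ => ℝ) 2 := ∑ k ∈ Finset.range (p.natDegree + 1),
    lp.single 2 k (√(α k) * p.coeff k)
  obtain ⟨f, hf, hn⟩ := exists_eq_inner_feature hα hsum hH a
  refine ⟨f, fun x => ?_, ?_⟩
  · rw [hf, inner_sum, Polynomial.eval_eq_sum_range, Finset.mul_sum]
    refine Finset.sum_congr rfl fun k _ => ?_
    rw [lp.inner_single_right, feature_apply]
    have h : √(α k) ≠ 0 := (Real.sqrt_pos.2 (hα k)).ne'
    simp only [RCLike.inner_apply, conj_trivial]
    field_simp
  · have h1 : ‖f‖ ^ 2 ≤ ‖a‖ ^ 2 := by gcongr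
    refine h1.trans (le_of_eq ?_)
    have := lp.norm_sum_single (p := 2) (E := fun _ : ℕ => ℝ) (by norm_num)
      (fun k => √(α k) * p.coeff k) (Finset.range (p.natDegree + 1))
    simp only [ENNReal.toReal_ofNat, Real.rpow_two] at this
    rw [this]
    refine Finset.sum_congr rfl fun k _ => ?_
    rw [Real.norm_eq_abs, sq_abs, mul_pow, Real.sq_sqrt (hα k).le]

/-- The error of a linear rule at a point in terms of its errors for the monomials. -/
lemma sq_apply_sub_sum_le (hα : ∀ k, 0 < α k) (hsum : Summable fun k => (α k)⁻¹)
    (hH : IsRKHSOf H (kernel φ α)) {n : ℕ} (pt : Fin n → Interval) (c : Fin n → ℝ)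
    (x : Interval) (f : H) :
    (f x - ∑ j, f (pt j) * c j) ^ 2 ≤ ‖f‖ ^ 2 *
      ∑' k : ℕ, (α k)⁻¹ * (φ x * (x : ℝ) ^ k - ∑ j, c j * (φ (pt j) * (pt j : ℝ) ^ k)) ^ 2 := by
  classical
  -- The error functional is represented by the combination `e d` of kernel functions.
  -- Cauchy–Schwarz applies in `H`, and the norm of `e d` is computed in `ℓ²`.
  let d : Interval →₀ ℝ := Finsupp.single x 1 - ∑ j, Finsupp.single (pt j) (c j)
  set e := Finsupp.linearCombination ℝ (fun x : Interval => RKHS.kerFun H x (1 : ℝ)) with he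
  set g := Finsupp.linearCombination ℝ (feature φ hα hsum) with hg
  have h1 : inner ℝ (e d) f = f x - ∑ j, f (pt j) * c j := by
    simp [he, d, inner_sub_left, sum_inner, inner_smul_left, mul_comm]
  have h2 : ‖e d‖ = ‖g d‖ := (norm_sum_feature hα hsum hH d).symm
  have h3 : ‖g d‖ ^ 2 = ∑' k : ℕ, (α k)⁻¹ *
      (φ x * (x : ℝ) ^ k - ∑ j, c j * (φ (pt j) * (pt j : ℝ) ^ k)) ^ 2 := by
    rw [← real_inner_self_eq_norm_sq, lp.inner_eq_tsum]
    refine tsum_congr fun k => ?_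
    have hk : (g d : ℕ → ℝ) k = (√(α k))⁻¹ *
        (φ x * (x : ℝ) ^ k - ∑ j, c j * (φ (pt j) * (pt j : ℝ) ^ k)) := by
      simp only [hg, d, map_sub, map_sum, Finsupp.linearCombination_single, one_smul, lp.coeFn_sub,
        lp.coeFn_sum, Pi.sub_apply, Finset.sum_apply, lp.coeFn_smul, Pi.smul_apply, feature_apply,
        smul_eq_mul, mul_sub, Finset.mul_sum]
      congr 1
      exact Finset.sum_congr rfl fun j _ => by ring
    rw [hk]
    simp only [RCLike.inner_apply, conj_trivial]
    rw [← sq, mul_pow, inv_pow, Real.sq_sqrt (hα k).le]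
  rw [← h1, ← h3, ← h2, mul_comm, ← mul_pow, ← sq_abs]
  gcongr
  exact abs_real_inner_le_norm _ _

end PowerSeriesKernel

end

/-! ### Lower bound: weighted coefficient norms via Chebyshev polynomials of the second kind -/

noncomputable section

namespace PowerSeriesKernel

-- The recursion `Uⱼ₊₂ = 2X Uⱼ₊₁ - Uⱼ` preserves parity and turns into Pascal's rule for the
-- binomial factors. Signs are irrelevant later, so only absolute values are bounded.
open Polynomial in
lemma coeff_chebyshev_U (j : ℕ) : ∀ i : ℕ,
    (∀ k, i + 2 * k = j → |(Chebyshev.U ℝ j).coeff i| ≤ 2 ^ i * ((i + k).choose k : ℝ)) ∧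
      ((∀ k, i + 2 * k ≠ j) → (Chebyshev.U ℝ j).coeff i = 0) := by
  induction j using Nat.strong_induction_on with
  | _ j ih =>
    match j, ih with
    | 0, _ =>
      intro i
      refine ⟨fun k hk => ?_, fun h => ?_⟩
      · obtain ⟨rfl, rfl⟩ : i = 0 ∧ k = 0 := by omega
        simp
      · have : i ≠ 0 := fun h0 => h 0 (by omega)
        simp [coeff_one, this]
    | 1, _ =>
      intro i
      have h2 : (Chebyshev.U ℝ ((1 : ℕ) : ℤ)).coeff i = if i = 1 then 2 else 0 := by
        have : (2 : ℝ[X]) * X = C 2 * X := by rw [C_ofNat]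
        simp [this, coeff_X, eq_comm]
      rw [h2]
      refine ⟨fun k hk => ?_, fun h => ?_⟩
      · obtain ⟨rfl, rfl⟩ : i = 1 ∧ k = 0 := by omega
        simp
      · have : i ≠ 1 := fun h0 => h 0 (by omega)
        simp [this]
    | j + 2, ih =>
      have hrec : Chebyshev.U ℝ ((j + 2 : ℕ) : ℤ) =
          C 2 * (X * Chebyshev.U ℝ ((j + 1 : ℕ) : ℤ)) - Chebyshev.U ℝ (j : ℤ) := by
        push_cast
        rw [Chebyshev.U_add_two, ← mul_assoc, C_ofNat]
      intro i
      cases i with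
      | zero =>
        have hc : (Chebyshev.U ℝ ((j + 2 : ℕ) : ℤ)).coeff 0 = -(Chebyshev.U ℝ (j : ℤ)).coeff 0 := by
          rw [hrec]; simp
        rw [hc]
        refine ⟨fun k hk => ?_, fun h => ?_⟩
        · have := (ih j (by omega) 0).1 (k - 1) (by omega)
          simpa using this
        · rw [(ih j (by omega) 0).2 fun k hk => h (k + 1) (by omega), neg_zero]
      | succ i =>
        have hc : (Chebyshev.U ℝ ((j + 2 : ℕ) : ℤ)).coeff (i + 1) =
            2 * (Chebyshev.U ℝ ((j + 1 : ℕ) : ℤ)).coeff i - (Chebyshev.U ℝ (j : ℤ)).coeff (i + 1) := by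
          rw [hrec]; simp
        rw [hc]
        refine ⟨fun k hk => ?_, fun h => ?_⟩
        · have h1 := (ih (j + 1) (by omega) i).1 k (by omega)
          refine (abs_sub _ _).trans ?_
          rw [abs_mul, abs_two]
          cases k with
          | zero =>
            rw [(ih j (by omega) (i + 1)).2 fun k' hk' => by omega]
            simp only [add_zero, Nat.choose_zero_right, Nat.cast_one, mul_one, abs_zero] at h1 ⊢
            rw [pow_succ]; linarith
          | succ k =>
            have h2 := (ih j (by omega) (i + 1)).1 k (by omega)
            have h3 : (i + 1 + (k + 1)).choose (k + 1) =
                (i + 1 + k).choose k + (i + (k + 1)).choose (k + 1) := by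
              rw [show i + 1 + (k + 1) = (i + 1 + k) + 1 by ring, Nat.choose_succ_succ,
                show i + 1 + k = i + (k + 1) by ring]
            rw [h3, Nat.cast_add ((i + 1 + k).choose k), mul_add]
            rw [pow_succ] at h2 ⊢
            linarith
        · rw [(ih (j + 1) (by omega) i).2 fun k hk => h k (by omega),
            (ih j (by omega) (i + 1)).2 fun k hk => h (k + 1) (by omega)]
          simp

/-- The left side equals `C(i+k,k) / (C(i+2k,k) k!²)`. One factor `1/k!` is enough to produce an
exponential series in `sum_mul_sq_coeff_chebyshev_U_le`. -/
lemma sq_choose_mul_factorial_div_le (i k : ℕ) :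
    ((i + k).choose k : ℝ) ^ 2 * ((i.factorial : ℝ) / ((i + 2 * k).factorial : ℝ)) ≤
      1 / (k.factorial : ℝ) := by
  have h1 : ((i + k).choose k : ℝ) * (i.factorial * k.factorial) = (i + k).factorial := by
    have := Nat.add_choose_mul_factorial_mul_factorial i k
    rw [← mul_assoc]; exact_mod_cast this
  have h2 : ((i + 2 * k).choose k : ℝ) * ((i + k).factorial * k.factorial) =
      (i + 2 * k).factorial := by
    have := Nat.add_choose_mul_factorial_mul_factorial (i + k) k
    rw [show i + k + k = i + 2 * k by ring] at this
    rw [← mul_assoc]; exact_mod_cast this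
  have h3 : ((i + k).choose k : ℝ) ≤ (i + 2 * k).choose k := by
    exact_mod_cast Nat.choose_le_choose k (by omega)
  have hi : (0 : ℝ) < i.factorial := by positivity
  have hk : (1 : ℝ) ≤ k.factorial := by exact_mod_cast Nat.factorial_pos k
  have hik : (0 : ℝ) < ((i + 2 * k).factorial : ℝ) := by positivity
  have hc : (0 : ℝ) ≤ ((i + k).choose k : ℝ) := by positivity
  have hc' : (0 : ℝ) < ((i + 2 * k).choose k : ℝ) := by exact_mod_cast Nat.choose_pos (by omega)
  rw [← mul_div_assoc, div_le_div_iff₀ hik (by positivity), one_mul, ← h2, ← h1]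
  set c := ((i + k).choose k : ℝ)
  set c' := ((i + 2 * k).choose k : ℝ)
  calc c ^ 2 * i.factorial * k.factorial = c * (c * i.factorial * k.factorial) * 1 := by ring
    _ ≤ c' * (c * i.factorial * k.factorial) * k.factorial := by gcongr
    _ = _ := by ring

open Polynomial in
/-- The weighted coefficient norm of the Chebyshev polynomials of the second kind. -/
lemma sum_mul_sq_coeff_chebyshev_U_le {α : ℕ → ℝ} (hα_pos : ∀ k, 0 < α k) {l : ℝ}
    (hα : ∀ n k : ℕ, k ≤ n →
      α k / α n ≤ l ^ (n - k) * ((k.factorial : ℝ) / (n.factorial : ℝ))) (j n : ℕ) :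
    ∑ i ∈ Finset.range (n + 1), α i * (Chebyshev.U ℝ j).coeff i ^ 2 ≤
      4 ^ j * α j * Real.exp (l ^ 2 / 16) := by
  have hterm : ∀ i k, i + 2 * k = j → α i * (Chebyshev.U ℝ j).coeff i ^ 2 ≤
      4 ^ j * α j * ((l ^ 2 / 16) ^ k / k.factorial) := by
    intro i k hik
    have h1 := (coeff_chebyshev_U j i).1 k hik
    have h2 := sq_choose_mul_factorial_div_le i k
    have h3 := (div_le_iff₀ (hα_pos j)).1 (hα j i (by omega))
    rw [show j - i = 2 * k by omega] at h3
    have h4 : (Chebyshev.U ℝ j).coeff i ^ 2 ≤ (2 ^ i * ((i + k).choose k : ℝ)) ^ 2 := by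
      rw [← sq_abs]; gcongr
    have h0 := (hα_pos i).le
    have hl : 0 ≤ l ^ (2 * k) := by rw [pow_mul]; positivity
    calc α i * (Chebyshev.U ℝ j).coeff i ^ 2
        ≤ (l ^ (2 * k) * ((i.factorial : ℝ) / (j.factorial : ℝ)) * α j) *
            (2 ^ i * ((i + k).choose k : ℝ)) ^ 2 := by
          gcongr
          exact h0.trans h3
      _ = 4 ^ i * α j * l ^ (2 * k) *
          (((i + k).choose k : ℝ) ^ 2 * ((i.factorial : ℝ) / ((i + 2 * k).factorial : ℝ))) := by
          rw [hik, mul_pow (2 ^ i), ← pow_mul 2, mul_comm i 2, pow_mul 2]; norm_num; ring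
      _ ≤ 4 ^ i * α j * l ^ (2 * k) * (1 / (k.factorial : ℝ)) := by
          have := (hα_pos j).le
          gcongr
      _ = 4 ^ j * α j * ((l ^ 2 / 16) ^ k / k.factorial) := by
          rw [← hik, pow_add, pow_mul, pow_mul, div_pow]; norm_num
          field_simp
  -- The degrees `j - 2k` are the only ones where `Uⱼ` can have a nonzero coefficient. At such a
  -- degree `4ⁱ λ²ᵏ = 4ʲ (λ²/16)ᵏ`, whence the exponential of `λ²/16`.
  let s := (Finset.range (j / 2 + 1)).image fun k => j - 2 * k
  have hnonneg : ∀ i, 0 ≤ α i * (Chebyshev.U ℝ j).coeff i ^ 2 := fun i =>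
    mul_nonneg (hα_pos i).le (sq_nonneg _)
  calc ∑ i ∈ Finset.range (n + 1), α i * (Chebyshev.U ℝ j).coeff i ^ 2
      ≤ ∑ i ∈ s, α i * (Chebyshev.U ℝ j).coeff i ^ 2 := by
        rw [← Finset.sum_filter_ne_zero]
        refine Finset.sum_le_sum_of_subset_of_nonneg (fun i hi => ?_) fun i _ _ => hnonneg i
        by_contra hs
        refine (Finset.mem_filter.1 hi).2 ?_
        rw [(coeff_chebyshev_U j i).2]
        · simp
        · intro k hk
          refine hs (Finset.mem_image.2 ⟨k, ?_, ?_⟩)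
          · simp; omega
          · omega
    _ = ∑ k ∈ Finset.range (j / 2 + 1), α (j - 2 * k) * (Chebyshev.U ℝ j).coeff (j - 2 * k) ^ 2 := by
        refine Finset.sum_image fun a ha b hb hab => ?_
        simp only [Finset.coe_range, Set.mem_Iio] at ha hb
        omega
    _ ≤ ∑ k ∈ Finset.range (j / 2 + 1), 4 ^ j * α j * ((l ^ 2 / 16) ^ k / k.factorial) := by
        refine Finset.sum_le_sum fun k hk => hterm _ _ ?_
        simp only [Finset.mem_range] at hk
        omega
    _ ≤ 4 ^ j * α j * Real.exp (l ^ 2 / 16) := by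
        rw [← Finset.mul_sum]
        have := (hα_pos j).le
        gcongr
        exact Real.sum_le_exp_of_nonneg (by positivity) _

open Polynomial in
/-- Every polynomial is a combination of Chebyshev polynomials of the second kind. -/
lemma exists_eq_sum_chebyshev_U (n : ℕ) : ∀ p : ℝ[X], p.natDegree < n →
    ∃ c : ℕ → ℝ, p = ∑ j ∈ Finset.range n, C (c j) * Chebyshev.U ℝ j := by
  induction n with
  | zero => intro p hp; omega
  | succ n ih =>
    intro p hp
    have hU : (Chebyshev.U ℝ (n : ℤ)).coeff n = 2 ^ n := by
      have := Chebyshev.leadingCoeff_U_natCast ℝ n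
      rwa [leadingCoeff, Chebyshev.natDegree_U_natCast] at this
    set a := p.coeff n / 2 ^ n with ha
    set q := p - C a * Chebyshev.U ℝ n with hq
    have hqn : q.coeff n = 0 := by
      simp [hq, hU, ha]
    have hqd : q.natDegree ≤ n := by
      refine (natDegree_sub_le _ _).trans (max_le (by omega) ?_)
      refine (natDegree_C_mul_le _ _).trans ?_
      rw [Chebyshev.natDegree_U_natCast]
    have hpq : p = q + C a * Chebyshev.U ℝ n := by rw [hq]; ring
    rcases Nat.eq_zero_or_pos n with rfl | hn
    · refine ⟨fun _ => a, ?_⟩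
      have : q = 0 := by
        rw [eq_C_of_natDegree_le_zero hqd, hqn, C_0]
      simpa [this] using hpq
    · have hlt : q.natDegree < n := by
        refine lt_of_le_of_ne hqd fun h => ?_
        have : q.leadingCoeff = 0 := by rw [leadingCoeff, h, hqn]
        rw [leadingCoeff_eq_zero] at this
        rw [this, natDegree_zero] at h
        omega
      obtain ⟨c, hc⟩ := ih q hlt
      refine ⟨fun j => if j = n then a else c j, ?_⟩
      rw [Finset.sum_range_succ, hpq]
      simp only [if_true]
      congr 1
      rw [hc]
      refine Finset.sum_congr rfl fun j hj => ?_
      rw [if_neg (by simp at hj; omega)]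

/-! ### Coordinates in the `Uⱼ` controlled by the unweighted `L²` norm -/

lemma integral_cos_int_mul {m : ℤ} (hm : m ≠ 0) :
    ∫ θ in (0 : ℝ)..Real.pi, Real.cos (m * θ) = 0 := by
  have hm' : (m : ℝ) ≠ 0 := Int.cast_ne_zero.2 hm
  rw [intervalIntegral.integral_comp_mul_left (fun θ => Real.cos θ) hm', integral_cos]
  simp

lemma integral_sin_mul_sin_natCast (a b : ℕ) :
    ∫ θ in (0 : ℝ)..Real.pi, Real.sin ((a + 1) * θ) * Real.sin ((b + 1) * θ) =
      if a = b then Real.pi / 2 else 0 := by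
  have h : ∀ θ : ℝ, Real.sin ((a + 1) * θ) * Real.sin ((b + 1) * θ) =
      (1 / 2) * (Real.cos (((a - b : ℤ) : ℝ) * θ) - Real.cos (((a + b + 2 : ℤ) : ℝ) * θ)) := by
    intro θ
    have h1 : (((a - b : ℤ) : ℝ) * θ) = (a + 1) * θ - (b + 1) * θ := by push_cast; ring
    have h2 : (((a + b + 2 : ℤ) : ℝ) * θ) = (a + 1) * θ + (b + 1) * θ := by push_cast; ring
    rw [h1, h2, Real.cos_sub, Real.cos_add]; ring
  simp_rw [h]
  rw [intervalIntegral.integral_const_mul, intervalIntegral.integral_sub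
    (Continuous.intervalIntegrable (by fun_prop) _ _)
    (Continuous.intervalIntegrable (by fun_prop) _ _), integral_cos_int_mul (by omega : (a + b + 2 : ℤ) ≠ 0)]
  split_ifs with hab
  · subst hab; simp; ring
  · rw [integral_cos_int_mul (by omega)]; simp

lemma integral_sq_sum_sin (c : ℕ → ℝ) (n : ℕ) :
    ∫ θ in (0 : ℝ)..Real.pi, (∑ j ∈ Finset.range n, c j * Real.sin ((j + 1) * θ)) ^ 2 =
      Real.pi / 2 * ∑ j ∈ Finset.range n, c j ^ 2 := by
  simp_rw [sq, Finset.sum_mul_sum]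
  rw [intervalIntegral.integral_finsetSum fun i _ =>
    Continuous.intervalIntegrable (by fun_prop) _ _, Finset.mul_sum]
  refine Finset.sum_congr rfl fun i hi => ?_
  rw [intervalIntegral.integral_finsetSum fun i _ =>
    Continuous.intervalIntegrable (by fun_prop) _ _]
  have : ∀ j ∈ Finset.range n, ∫ θ in (0 : ℝ)..Real.pi,
      c i * Real.sin ((i + 1) * θ) * (c j * Real.sin ((j + 1) * θ)) =
      if i = j then Real.pi / 2 * (c i * c i) else 0 := by
    intro j _
    have h : ∀ θ : ℝ, c i * Real.sin ((i + 1) * θ) * (c j * Real.sin ((j + 1) * θ)) =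
      (c i * c j) * (Real.sin ((i + 1) * θ) * Real.sin ((j + 1) * θ)) := fun θ => by ring
    simp_rw [h]
    rw [intervalIntegral.integral_const_mul, integral_sin_mul_sin_natCast]
    split_ifs with hij
    · subst hij; ring
    · ring
  rw [Finset.sum_congr rfl this, Finset.sum_ite_eq, if_pos hi]

-- Substituting `x = cos θ`, `Uⱼ(cos θ) sin θ = sin((j+1)θ)` makes the left side the integral of
-- `p(cos θ)² sin² θ`; the right side has `sin θ ≥ sin² θ` instead.
open Polynomial in
lemma integral_sq_sum_chebyshev_U_ge (c : ℕ → ℝ) (n : ℕ) (p : ℝ[X])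
    (hp : p = ∑ j ∈ Finset.range n, C (c j) * Chebyshev.U ℝ j) :
    Real.pi / 2 * ∑ j ∈ Finset.range n, c j ^ 2 ≤ ∫ x in (-1 : ℝ)..1, p.eval x ^ 2 := by
  have hsub : ∫ x in (-1 : ℝ)..1, p.eval x ^ 2 =
      ∫ θ in (0 : ℝ)..Real.pi, p.eval (Real.cos θ) ^ 2 * Real.sin θ := by
    have h := intervalIntegral.integral_comp_mul_deriv (a := 0) (b := Real.pi) (f := Real.cos)
      (f' := fun θ => -Real.sin θ) (g := fun x => p.eval x ^ 2)
      (fun θ _ => Real.hasDerivAt_cos θ) (by fun_prop) (by fun_prop)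
    simp only [Function.comp_apply, Real.cos_zero, Real.cos_pi, mul_neg] at h
    rw [intervalIntegral.integral_neg, intervalIntegral.integral_symm (-1)] at h
    linarith
  rw [hsub, ← integral_sq_sum_sin]
  refine intervalIntegral.integral_mono_on Real.pi_pos.le
    (Continuous.intervalIntegrable (by fun_prop) _ _)
    (Continuous.intervalIntegrable (by fun_prop) _ _) fun θ hθ => ?_
  have h : ∑ j ∈ Finset.range n, c j * Real.sin ((j + 1) * θ) = p.eval (Real.cos θ) * Real.sin θ := by
    rw [hp, eval_finsetSum, Finset.sum_mul]
    refine Finset.sum_congr rfl fun j _ => ?_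
    have := Chebyshev.U_real_cos θ j
    rw [eval_mul, eval_C, mul_assoc, this]
    simp
  rw [h, mul_pow]
  have h0 := Real.sin_nonneg_of_mem_Icc hθ
  have h1 := Real.sin_le_one θ
  gcongr
  nlinarith

open Polynomial in
/-- The weighted coefficient norm of a polynomial is controlled by its `L²` norm. -/
lemma sum_mul_sq_coeff_le_integral {α : ℕ → ℝ} (hα_pos : ∀ k, 0 < α k) {l : ℝ}
    (hα : ∀ n k : ℕ, k ≤ n →
      α k / α n ≤ l ^ (n - k) * ((k.factorial : ℝ) / (n.factorial : ℝ)))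
    {n : ℕ} {p : ℝ[X]} (hp : p.natDegree ≤ n) :
    ∑ k ∈ Finset.range (n + 1), α k * p.coeff k ^ 2 ≤
      2 / Real.pi * (∫ x in (-1 : ℝ)..1, p.eval x ^ 2) *
        (Real.exp (l ^ 2 / 16) * ∑ j ∈ Finset.range (n + 1), 4 ^ j * α j) := by
  obtain ⟨c, hc⟩ := exists_eq_sum_chebyshev_U (n + 1) p (by omega)
  have hI := integral_sq_sum_chebyshev_U_ge c (n + 1) p hc
  set I := ∫ x in (-1 : ℝ)..1, p.eval x ^ 2
  have hc2 : ∑ j ∈ Finset.range (n + 1), c j ^ 2 ≤ 2 / Real.pi * I := by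
    have := Real.pi_pos
    rw [div_mul_eq_mul_div, le_div_iff₀ this]; linarith
  -- Cauchy–Schwarz over `j` costs a sum over all `Uⱼ` instead of a maximum. This is harmless
  -- because the weighted norms of the `Uⱼ` grow geometrically.
  have hcoeff : ∀ k, p.coeff k ^ 2 ≤ (∑ j ∈ Finset.range (n + 1), c j ^ 2) *
      ∑ j ∈ Finset.range (n + 1), (Chebyshev.U ℝ j).coeff k ^ 2 := by
    intro k
    have : p.coeff k = ∑ j ∈ Finset.range (n + 1), c j * (Chebyshev.U ℝ j).coeff k := by
      conv_lhs => rw [hc]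
      simp
    rw [this]
    exact Finset.sum_mul_sq_le_sq_mul_sq _ _ _
  calc ∑ k ∈ Finset.range (n + 1), α k * p.coeff k ^ 2
      ≤ ∑ k ∈ Finset.range (n + 1), α k * ((∑ j ∈ Finset.range (n + 1), c j ^ 2) *
          ∑ j ∈ Finset.range (n + 1), (Chebyshev.U ℝ j).coeff k ^ 2) := by
        refine Finset.sum_le_sum fun k _ => ?_
        exact mul_le_mul_of_nonneg_left (hcoeff k) (hα_pos k).le
    _ = (∑ j ∈ Finset.range (n + 1), c j ^ 2) * ∑ j ∈ Finset.range (n + 1),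
          ∑ k ∈ Finset.range (n + 1), α k * (Chebyshev.U ℝ j).coeff k ^ 2 := by
        rw [Finset.sum_comm, Finset.mul_sum]
        refine Finset.sum_congr rfl fun k _ => ?_
        rw [← Finset.mul_sum]; ring
    _ ≤ (2 / Real.pi * I) * (Real.exp (l ^ 2 / 16) * ∑ j ∈ Finset.range (n + 1), 4 ^ j * α j) := by
        have h0 : 0 ≤ ∑ j ∈ Finset.range (n + 1), c j ^ 2 :=
          Finset.sum_nonneg fun j _ => sq_nonneg _
        refine mul_le_mul hc2 ?_ ?_ (h0.trans hc2)
        · rw [Finset.mul_sum]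
          refine Finset.sum_le_sum fun j _ => ?_
          rw [mul_comm (Real.exp _)]
          exact sum_mul_sq_coeff_chebyshev_U_le hα_pos hα j n
        · exact Finset.sum_nonneg fun j _ => Finset.sum_nonneg fun k _ =>
            mul_nonneg (hα_pos k).le (sq_nonneg _)

/-- Induction on `i` costs a factor `(1 + 1/(j+i))ⁱ ≤ e ≤ 4` at each step. -/
lemma add_pow_mul_factorial_le (j i : ℕ) :
    ((j + i : ℕ) : ℝ) ^ i * (j.factorial : ℝ) ≤ 4 ^ i * ((j + i).factorial : ℝ) := by
  induction i with
  | zero => simp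
  | succ i ih =>
    have h1 : (((j + i : ℕ) : ℝ) + 1) ^ i ≤ 4 * ((j + i : ℕ) : ℝ) ^ i := by
      rcases Nat.eq_zero_or_pos i with rfl | hi
      · norm_num
      · have hN : (0 : ℝ) < ((j + i : ℕ) : ℝ) := by exact_mod_cast (by omega : 0 < j + i)
        have h2 : ((j + i : ℕ) : ℝ) + 1 = ((j + i : ℕ) : ℝ) * (1 + 1 / ((j + i : ℕ) : ℝ)) := by
          field_simp
        have h3 : (1 + 1 / ((j + i : ℕ) : ℝ)) ^ i ≤ 4 := by
          calc (1 + 1 / ((j + i : ℕ) : ℝ)) ^ i ≤ (Real.exp (1 / ((j + i : ℕ) : ℝ))) ^ i := by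
                gcongr
                rw [add_comm]; exact Real.add_one_le_exp _
            _ = Real.exp (i * (1 / ((j + i : ℕ) : ℝ))) := (Real.exp_nat_mul _ _).symm
            _ ≤ Real.exp 1 := by
                rw [Real.exp_le_exp, mul_one_div, div_le_one hN]
                exact_mod_cast Nat.le_add_left i j
            _ ≤ 4 := by have := Real.exp_one_lt_d9; linarith
        rw [h2, mul_pow, mul_comm]
        gcongr
    have h4 : ((j + (i + 1)).factorial : ℝ) = (((j + i : ℕ) : ℝ) + 1) * (j + i).factorial := by
      rw [← add_assoc, Nat.factorial_succ]; push_cast; ring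
    have h5 : ((j + (i + 1) : ℕ) : ℝ) = ((j + i : ℕ) : ℝ) + 1 := by push_cast; ring
    rw [h4, h5]
    calc (((j + i : ℕ) : ℝ) + 1) ^ (i + 1) * j.factorial
        = (((j + i : ℕ) : ℝ) + 1) * ((((j + i : ℕ) : ℝ) + 1) ^ i * j.factorial) := by ring
      _ ≤ (((j + i : ℕ) : ℝ) + 1) * (4 * ((j + i : ℕ) : ℝ) ^ i * j.factorial) := by gcongr
      _ = (((j + i : ℕ) : ℝ) + 1) * (4 * (((j + i : ℕ) : ℝ) ^ i * j.factorial)) := by ring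
      _ ≤ (((j + i : ℕ) : ℝ) + 1) * (4 * (4 ^ i * ((j + i).factorial : ℝ))) := by gcongr
      _ = _ := by ring

/-- Since `λ ≤ n/5`, going down `i` indices multiplies `α` by at most `(4/5)ⁱ`. This is relaxed to
`2ⁱ`, which against `4⁻ⁱ` leaves ratio `1/2`. -/
lemma sum_four_pow_mul_le {α : ℕ → ℝ} (hα_pos : ∀ k, 0 < α k) {l : ℝ} (hl : 0 < l)
    (hα : ∀ n k : ℕ, k ≤ n →
      α k / α n ≤ l ^ (n - k) * ((k.factorial : ℝ) / (n.factorial : ℝ)))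
    {n : ℕ} (hn : 5 * l ≤ n) :
    ∑ j ∈ Finset.range (n + 1), 4 ^ j * α j ≤ 2 * (4 ^ n * α n) := by
  have hterm : ∀ i ∈ Finset.range (n + 1),
      4 ^ (n - i) * α (n - i) ≤ 4 ^ n * α n * (1 / 2) ^ i := by
    intro i hi
    obtain ⟨j, rfl⟩ : ∃ j, n = j + i := ⟨n - i, by simp at hi; omega⟩
    have h1 := (div_le_iff₀ (hα_pos (j + i))).1 (hα (j + i) j (by omega))
    rw [Nat.add_sub_cancel_left] at h1
    rw [Nat.add_sub_cancel]
    have h2 := add_pow_mul_factorial_le j i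
    have h3 : l ^ i * (j.factorial : ℝ) ≤ 2 ^ i * ((j + i).factorial : ℝ) := by
      have : l ≤ ((j + i : ℕ) : ℝ) / 5 := by linarith
      calc l ^ i * (j.factorial : ℝ) ≤ (((j + i : ℕ) : ℝ) / 5) ^ i * j.factorial := by gcongr
        _ = (((j + i : ℕ) : ℝ) ^ i * j.factorial) / 5 ^ i := by rw [div_pow]; ring
        _ ≤ (4 ^ i * ((j + i).factorial : ℝ)) / 5 ^ i := by gcongr
        _ = (4 / 5) ^ i * ((j + i).factorial : ℝ) := by rw [div_pow]; ring
        _ ≤ 2 ^ i * ((j + i).factorial : ℝ) := by gcongr; norm_num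
    have h4 : l ^ i * ((j.factorial : ℝ) / ((j + i).factorial : ℝ)) ≤ 2 ^ i := by
      rw [← mul_div_assoc, div_le_iff₀ (by positivity)]; exact h3
    have h5 := (hα_pos (j + i)).le
    calc 4 ^ j * α j ≤ 4 ^ j * (2 ^ i * α (j + i)) := by
          gcongr
          exact h1.trans (by gcongr)
      _ = 4 ^ (j + i) * α (j + i) * (1 / 2) ^ i := by
          rw [pow_add, show (4 : ℝ) = 2 * 2 by norm_num, mul_pow 2 2 i, one_div, inv_pow]
          field_simp
  rw [← Finset.sum_range_reflect]
  have h0 := (hα_pos n).le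
  calc ∑ j ∈ Finset.range (n + 1), 4 ^ (n + 1 - 1 - j) * α (n + 1 - 1 - j)
      ≤ ∑ i ∈ Finset.range (n + 1), 4 ^ n * α n * (1 / 2) ^ i := Finset.sum_le_sum hterm
    _ = 4 ^ n * α n * ∑ i ∈ Finset.range (n + 1), (1 / 2 : ℝ) ^ i := by rw [Finset.mul_sum]
    _ ≤ 4 ^ n * α n * 2 := by
        gcongr
        exact sum_geometric_two_le _
    _ = _ := by ring

end PowerSeriesKernel

end

/-! ### Upper bound: interpolation of monomials at the Chebyshev nodes -/

noncomputable section

namespace PowerSeriesKernel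

/-- The zeros of the Chebyshev polynomial `Tₙ`. -/
def chebyshevNode (n : ℕ) (k : Fin n) : ℝ := Real.cos ((2 * (k : ℕ) + 1) * Real.pi / (2 * n))

lemma chebyshevNode_mem (n : ℕ) (k : Fin n) : chebyshevNode n k ∈ Set.Icc (-1 : ℝ) 1 :=
  Real.cos_mem_Icc _

lemma chebyshevNode_injective (n : ℕ) : Function.Injective (chebyshevNode n) := by
  have h := Polynomial.Chebyshev.roots_T_real_nodup n
  rw [← Finset.range_val, (Finset.range n).nodup_map_iff_injOn] at h
  intro a b hab
  exact Fin.ext (h (by simp) (by simp) hab)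

open Polynomial in
lemma eval_T_chebyshevNode (n : ℕ) (k : Fin n) :
    (Chebyshev.T ℝ n).eval (chebyshevNode n k) = 0 := by
  have : chebyshevNode n k ∈ (Chebyshev.T ℝ n).roots := by
    rw [Chebyshev.roots_T_real, Finset.mem_val, Finset.mem_image]
    exact ⟨k, by simp, rfl⟩
  exact (mem_roots'.1 this).2

/-- The error at `x` of polynomial interpolation at the Chebyshev nodes. -/
def interpError (n : ℕ) (x : ℝ) (p : Polynomial ℝ) : ℝ :=
  p.eval x - ∑ j, p.eval (chebyshevNode n j) *
    (Lagrange.basis Finset.univ (chebyshevNode n) j).eval x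

open Polynomial

variable {n : ℕ} {x : ℝ}

lemma interpError_add (p q : ℝ[X]) :
    interpError n x (p + q) = interpError n x p + interpError n x q := by
  simp only [interpError, eval_add, add_mul, Finset.sum_add_distrib]
  ring

lemma interpError_C_mul (c : ℝ) (p : ℝ[X]) :
    interpError n x (C c * p) = c * interpError n x p := by
  simp only [interpError, eval_mul, eval_C, mul_sub, Finset.mul_sum]
  congr 1
  exact Finset.sum_congr rfl fun j _ => by ring

lemma interpError_eq_of_eval_eq {p q : ℝ[X]} (hq : q.degree < n)
    (h : ∀ j, q.eval (chebyshevNode n j) = p.eval (chebyshevNode n j)) :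
    interpError n x p = p.eval x - q.eval x := by
  have h1 := Lagrange.eq_interpolate (s := Finset.univ) (v := chebyshevNode n) (f := q)
    (chebyshevNode_injective n).injOn (by simpa using hq)
  have h2 : q.eval x = ∑ j, q.eval (chebyshevNode n j) *
      (Lagrange.basis Finset.univ (chebyshevNode n) j).eval x := by
    conv_lhs => rw [h1]
    simp [Lagrange.interpolate_apply, eval_finsetSum]
  simp only [interpError, h2, h]

lemma interpError_eq_zero {p : ℝ[X]} (hp : p.degree < n) : interpError n x p = 0 := by
  rw [interpError_eq_of_eval_eq hp fun _ => rfl, sub_self]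

/-- Aliasing: on the nodes every Chebyshev polynomial agrees with a bounded one of low degree. -/
lemma exists_alias_T (hn : 0 < n) (k : ℕ) : ∃ q : ℝ[X], q.degree < n ∧
    (∀ x ∈ Set.Icc (-1 : ℝ) 1, |q.eval x| ≤ 1) ∧
    ∀ j, q.eval (chebyshevNode n j) = (Chebyshev.T ℝ k).eval (chebyshevNode n j) := by
  induction k using Nat.strong_induction_on with
  | _ k ih =>
    rcases lt_trichotomy k n with h | h | h
    · refine ⟨Chebyshev.T ℝ k, ?_, fun x hx => ?_, fun _ => rfl⟩
      · rw [Chebyshev.degree_T]; simpa using h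
      · exact Chebyshev.abs_eval_T_real_le_one _ (abs_le.2 hx)
    · subst h
      refine ⟨0, by simp, by simp, fun j => ?_⟩
      rw [eval_T_chebyshevNode, eval_zero]
    · obtain ⟨q, hq, hq1, hq2⟩ := ih ((n : ℤ) - (k - n : ℕ)).natAbs (by omega)
      refine ⟨-q, by simpa using hq, by simpa using hq1, fun j => ?_⟩
      -- At the nodes `2 Tₙ Tₖ₋ₙ = Tₖ + T₂ₙ₋ₖ` vanishes, so `Tₖ` agrees there with `-T₂ₙ₋ₖ`, whose
      -- index is smaller than `k` in absolute value.
      have h1 := congrArg (eval (chebyshevNode n j)) (Chebyshev.T_mul_T ℝ n ((k - n : ℕ) : ℤ))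
      rw [eval_mul, eval_mul, eval_T_chebyshevNode, eval_add, ← Chebyshev.T_natAbs _ (_ - _),
        ← hq2 j, show ((n : ℤ) + (k - n : ℕ)) = k by omega] at h1
      rw [eval_neg]
      linarith

/-- The interpolant of `Tₖ` is its alias, again bounded by `1`, so no Lebesgue constant enters. -/
lemma abs_interpError_T_le (hn : 0 < n) (hx : x ∈ Set.Icc (-1 : ℝ) 1) (k : ℤ) :
    |interpError n x (Chebyshev.T ℝ k)| ≤ 2 := by
  rw [← Chebyshev.T_natAbs]
  obtain ⟨q, hq, hq1, hq2⟩ := exists_alias_T hn k.natAbs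
  rw [interpError_eq_of_eval_eq hq hq2]
  have h1 := hq1 x hx
  have h2 := Chebyshev.abs_eval_T_real_le_one k.natAbs (abs_le.2 hx)
  refine (abs_sub _ _).trans ?_
  linarith

/-- Multiplication by `X` averages `Tₖ₊₁` and `Tₖ₋₁`, a random walk step in `k`. The majorant
`s^(n-k) + s^(n+k)` is an eigenfunction of this averaging with eigenvalue `(s + s⁻¹)/2`, and
dominates the case `N = 0`, where the error vanishes for `|k| < n`. Carrying all integers `k` makes
the induction close. -/
lemma abs_interpError_X_pow_mul_T_le (hn : 0 < n) (hx : x ∈ Set.Icc (-1 : ℝ) 1) {s : ℝ}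
    (hs : 0 < s) (hs1 : s ≤ 1) (N : ℕ) : ∀ k : ℤ,
    |interpError n x (X ^ N * Chebyshev.T ℝ k)| ≤
      2 * ((s + s⁻¹) / 2) ^ N * (s ^ ((n : ℤ) - k) + s ^ ((n : ℤ) + k)) := by
  induction N with
  | zero =>
    intro k
    simp only [pow_zero, one_mul, mul_one]
    have h1 : 0 < s ^ ((n : ℤ) - k) := zpow_pos hs _
    have h2 : 0 < s ^ ((n : ℤ) + k) := zpow_pos hs _
    have hone : ∀ e : ℤ, e ≤ 0 → 1 ≤ s ^ e := fun e he => by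
      have := zpow_le_zpow_right_of_le_one₀ hs hs1 he
      simpa using this
    by_cases hk : k.natAbs < n
    · rw [interpError_eq_zero, abs_zero]
      · positivity
      · rw [Chebyshev.degree_T]; exact_mod_cast hk
    · refine (abs_interpError_T_le hn hx k).trans ?_
      rcases le_total 0 k with h0 | h0
      · have := hone (n - k) (by omega)
        linarith
      · have := hone (n + k) (by omega)
        linarith
  | succ N ih =>
    intro k
    have hX : X ^ (N + 1) * Chebyshev.T ℝ k =
        C (1 / 2) * (X ^ N * Chebyshev.T ℝ (k + 1) + X ^ N * Chebyshev.T ℝ (k - 1)) := by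
      have h2 : (C (1 / 2) : ℝ[X]) * 2 = 1 := by
        rw [← C_ofNat, ← C_mul]; norm_num
      have h := Chebyshev.T_add_one ℝ k
      rw [h]
      linear_combination (-X ^ N * X * Chebyshev.T ℝ k) * h2
    rw [hX, interpError_C_mul, interpError_add, abs_mul, abs_of_pos (by norm_num : (0 : ℝ) < 1 / 2)]
    have h1 := ih (k + 1)
    have h2 := ih (k - 1)
    have h3 := abs_add_le (interpError n x (X ^ N * Chebyshev.T ℝ (k + 1)))
      (interpError n x (X ^ N * Chebyshev.T ℝ (k - 1)))
    have e1 : s ^ ((n : ℤ) - (k + 1)) = s ^ ((n : ℤ) - k) * s⁻¹ := by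
      rw [← zpow_sub_one₀ hs.ne']; congr 1; ring
    have e2 : s ^ ((n : ℤ) + (k + 1)) = s ^ ((n : ℤ) + k) * s := by
      rw [← zpow_add_one₀ hs.ne']; congr 1; ring
    have e3 : s ^ ((n : ℤ) - (k - 1)) = s ^ ((n : ℤ) - k) * s := by
      rw [← zpow_add_one₀ hs.ne']; congr 1; ring
    have e4 : s ^ ((n : ℤ) + (k - 1)) = s ^ ((n : ℤ) + k) * s⁻¹ := by
      rw [← zpow_sub_one₀ hs.ne']; congr 1; ring
    rw [e1, e2] at h1
    rw [e3, e4] at h2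
    calc 1 / 2 * |_| ≤ 1 / 2 * (2 * ((s + s⁻¹) / 2) ^ N *
            (s ^ ((n : ℤ) - k) * s⁻¹ + s ^ ((n : ℤ) + k) * s) +
          2 * ((s + s⁻¹) / 2) ^ N * (s ^ ((n : ℤ) - k) * s + s ^ ((n : ℤ) + k) * s⁻¹)) := by
          gcongr; linarith
      _ = _ := by rw [pow_succ]; ring

lemma abs_interpError_X_pow_le (hn : 0 < n) (hx : x ∈ Set.Icc (-1 : ℝ) 1) {s : ℝ}
    (hs : 0 < s) (hs1 : s ≤ 1) (N : ℕ) :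
    |interpError n x (X ^ N)| ≤ 4 * s ^ n * ((s + s⁻¹) / 2) ^ N := by
  have h := abs_interpError_X_pow_mul_T_le hn hx hs hs1 N 0
  rw [Chebyshev.T_zero, mul_one, sub_zero, add_zero, zpow_natCast] at h
  linarith

/-- The squared worst-case interpolation error at a point. -/
lemma tsum_sq_interpError_le {α : ℕ → ℝ} (hα_pos : ∀ k, 0 < α k) {l : ℝ} (hl : 0 < l)
    (hα : ∀ n k : ℕ, k ≤ n →
      α k / α n ≤ l ^ (n - k) * ((k.factorial : ℝ) / (n.factorial : ℝ)))
    (hn : 0 < n) (hln : 5 * l ≤ n) (hx : x ∈ Set.Icc (-1 : ℝ) 1) :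
    ∑' k : ℕ, (α k)⁻¹ * interpError n x (X ^ k) ^ 2 ≤
      (α n)⁻¹ * (1 / 4) ^ n * (41 * Real.exp l) := by
  have hn' : (0 : ℝ) < n := by exact_mod_cast hn
  -- The free parameter is `s = √r`. With this `r`, the factor `(1 + r)²ⁿ` stays below `e^λ`, while
  -- the decay `(λ/n)ᵐ = (2r)ᵐ` of `αₙ / αₙ₊ₘ` beats the growth `((1 + r)²/(4r))ᵐ` of the squared
  -- errors, leaving ratio `q` near `1/2`.
  set r := l / (2 * n) with hr
  have hr0 : 0 < r := by positivity
  have hr1 : r ≤ 1 / 10 := by rw [hr, div_le_iff₀ (by positivity)]; linarith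
  have hs : 0 < √r := Real.sqrt_pos.2 hr0
  have hs1 : √r ≤ 1 := Real.sqrt_le_one.2 (by linarith)
  have hss : √r ^ 2 = r := Real.sq_sqrt hr0.le
  have hαn := inv_pos.2 (hα_pos n)
  set q := (1 + r) ^ 2 / 2 with hq
  have hq0 : 0 ≤ q := by positivity
  have hq1 : q ≤ 605 / 1000 := by rw [hq]; nlinarith
  have hsq : ((√r + (√r)⁻¹) / 2) ^ 2 = (1 + r) ^ 2 / (4 * r) := by
    rw [div_pow, add_sq, inv_pow, hss, mul_assoc, mul_inv_cancel₀ hs.ne']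
    field_simp
    ring
  have hterm : ∀ m : ℕ, (α (n + m))⁻¹ * interpError n x (X ^ (n + m)) ^ 2 ≤
      (α n)⁻¹ * (1 / 4) ^ n * (16 * Real.exp l) * q ^ m := by
    intro m
    have h1 := abs_interpError_X_pow_le hn hx hs hs1 (n + m)
    have h2 : interpError n x (X ^ (n + m)) ^ 2 ≤
        16 * r ^ n * ((1 + r) ^ 2 / (4 * r)) ^ (n + m) := by
      rw [← sq_abs]
      calc |interpError n x (X ^ (n + m))| ^ 2
          ≤ (4 * √r ^ n * ((√r + (√r)⁻¹) / 2) ^ (n + m)) ^ 2 := by gcongr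
        _ = 16 * (√r ^ 2) ^ n * (((√r + (√r)⁻¹) / 2) ^ 2) ^ (n + m) := by
            rw [mul_pow, mul_pow, ← pow_mul, ← pow_mul, ← pow_mul, ← pow_mul, mul_comm n,
              mul_comm (n + m)]
            norm_num
        _ = _ := by rw [hss, hsq]
    have h3 : (α (n + m))⁻¹ ≤ (α n)⁻¹ * (2 * r) ^ m := by
      have h := hα (n + m) n (by omega)
      rw [Nat.add_sub_cancel_left] at h
      have hf : l ^ m * ((n.factorial : ℝ) / ((n + m).factorial : ℝ)) ≤ (2 * r) ^ m := by
        have hfac : (n.factorial : ℝ) * (n : ℝ) ^ m ≤ ((n + m).factorial : ℝ) := by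
          have h6 := Nat.factorial_mul_pow_le_factorial (m := n) (n := m)
          calc (n.factorial : ℝ) * (n : ℝ) ^ m ≤ (n.factorial : ℝ) * ((n + 1 : ℕ) : ℝ) ^ m := by
                gcongr; simp
            _ ≤ _ := by exact_mod_cast h6
        have h2r : 2 * r = l / n := by rw [hr]; field_simp
        rw [h2r, div_pow, ← mul_div_assoc, div_le_div_iff₀ (by positivity) (by positivity),
          mul_assoc]
        gcongr
      have h' := h.trans hf
      rw [div_le_iff₀ (hα_pos _)] at h'
      rw [inv_mul_eq_div, le_div_iff₀ (hα_pos n), inv_mul_le_iff₀ (hα_pos _)]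
      linarith
    have h4 : (1 + r) ^ (2 * n) ≤ Real.exp l := by
      have : 1 + r ≤ Real.exp r := by rw [add_comm]; exact Real.add_one_le_exp r
      calc (1 + r) ^ (2 * n) ≤ Real.exp r ^ (2 * n) := by gcongr
        _ = Real.exp l := by
          rw [← Real.exp_nat_mul]; congr 1; rw [hr]; push_cast; field_simp
    calc (α (n + m))⁻¹ * interpError n x (X ^ (n + m)) ^ 2
        ≤ ((α n)⁻¹ * (2 * r) ^ m) * (16 * r ^ n * ((1 + r) ^ 2 / (4 * r)) ^ (n + m)) := by
          gcongr
      _ = (α n)⁻¹ * (1 / 4) ^ n * (16 * (1 + r) ^ (2 * n)) * q ^ m := by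
          have e1 : ((1 + r) ^ 2 / (4 * r)) ^ n = (1 / 4) ^ n * (1 + r) ^ (2 * n) / r ^ n := by
            rw [div_pow _ (4 * r), mul_pow 4 r, ← pow_mul, div_pow 1 4, one_pow, div_mul_eq_mul_div,
              one_mul, div_div]
          have e2 : q ^ m = (2 * r) ^ m * ((1 + r) ^ 2 / (4 * r)) ^ m := by
            rw [← mul_pow]; congr 1; rw [hq]; field_simp; norm_num
          rw [pow_add, e1, e2]; field_simp
      _ ≤ _ := by gcongr
  have hnonneg : ∀ k, 0 ≤ (α k)⁻¹ * interpError n x (X ^ k) ^ 2 := fun k =>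
    mul_nonneg (inv_pos.2 (hα_pos k)).le (sq_nonneg _)
  refine Real.tsum_le_of_sum_range_le hnonneg fun M => ?_
  calc ∑ k ∈ Finset.range M, (α k)⁻¹ * interpError n x (X ^ k) ^ 2
      ≤ ∑ k ∈ Finset.range (n + M), (α k)⁻¹ * interpError n x (X ^ k) ^ 2 :=
        Finset.sum_le_sum_of_subset_of_nonneg (Finset.range_mono (by omega))
          fun k _ _ => hnonneg k
    _ = ∑ m ∈ Finset.range M, (α (n + m))⁻¹ * interpError n x (X ^ (n + m)) ^ 2 := by
        rw [Finset.sum_range_add, Finset.sum_eq_zero, zero_add]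
        intro k hk
        rw [interpError_eq_zero]
        · simp
        · rw [degree_X_pow]; exact_mod_cast Finset.mem_range.1 hk
    _ ≤ ∑ m ∈ Finset.range M, (α n)⁻¹ * (1 / 4) ^ n * (16 * Real.exp l) * q ^ m :=
        Finset.sum_le_sum fun m _ => hterm m
    _ = (α n)⁻¹ * (1 / 4) ^ n * (16 * Real.exp l) * ∑ m ∈ Finset.range M, q ^ m := by
        rw [Finset.mul_sum]
    _ ≤ (α n)⁻¹ * (1 / 4) ^ n * (16 * Real.exp l) * (1 - q)⁻¹ := by
        gcongr
        rw [← tsum_geometric_of_lt_one hq0 (by linarith)]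
        exact (summable_geometric_of_lt_one hq0 (by linarith)).sum_le_tsum _
          fun _ _ => by positivity
    -- Here `1 - q ≥ 0.395 > 16/41`, which is the origin of `41`.
    _ ≤ (α n)⁻¹ * (1 / 4) ^ n * (16 * Real.exp l) * (41 / 16) := by
        gcongr
        rw [inv_le_comm₀ (by linarith) (by norm_num)]
        norm_num; linarith
    _ = _ := by ring

/-- In terms of `y = √(λn)` the right side grows like `e^(2y) / √y`, so everything reduces to linear
inequalities in `y` once `y ≥ 3` and `λ ≤ y/2.2` are known. -/
lemma exp_mul_le_cL {l : ℝ} (hl : 0 < l) (hn : mL l ≤ n) :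
    41 * Real.exp l ≤ 4 * (cL l * (n : ℝ) ^ (-(1 / 4) : ℝ) * Real.exp (2 * √(l * n))) := by
  have h5 : 5 * l ≤ n := (le_max_left _ _).trans hn
  have h9 : 9 / l ≤ n := (le_max_right _ _).trans ((le_max_right _ _).trans hn)
  have hn' : (0 : ℝ) < n := by linarith
  set y := √(l * n) with hy
  have hyy : y ^ 2 = l * n := Real.sq_sqrt (by positivity)
  have hy0 : 0 ≤ y := Real.sqrt_nonneg _
  have hy3 : 3 ≤ y := by
    rw [div_le_iff₀ hl] at h9
    exact Real.le_sqrt_of_sq_le (by linarith)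
  have hyl : 2.2 * l ≤ y := Real.le_sqrt_of_sq_le (by nlinarith)
  have hroot : l ^ (1 / 4 : ℝ) * (n : ℝ) ^ (1 / 4 : ℝ) = √y := by
    rw [← Real.mul_rpow hl.le hn'.le, hy, Real.sqrt_eq_rpow, Real.sqrt_eq_rpow, ← Real.rpow_mul
      (by positivity)]
    norm_num
  have hl4 : 0 < l ^ (1 / 4 : ℝ) := by positivity
  have hsl : 0 < √l := Real.sqrt_pos.2 hl
  have hB : 29 / 5 ≤ 3 + √(Real.pi / Real.exp 1) + 2 / (√Real.pi * l ^ (1 / 4 : ℝ)) + 7 / (16 * √l)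
      + √l * (2 + l) := by
    -- The bound `29/5` is `3 + 1 + 9/5`, the last summand by the inequality of arithmetic and
    -- geometric means.
    have h1 : 1 ≤ √(Real.pi / Real.exp 1) := by
      rw [Real.one_le_sqrt, one_le_div (Real.exp_pos _)]
      have := Real.exp_one_lt_d9; have := Real.pi_gt_three; linarith
    have h2 : 0 ≤ 2 / (√Real.pi * l ^ (1 / 4 : ℝ)) := by positivity
    have h3 : 9 / 5 ≤ 7 / (16 * √l) + √l * 2 := by
      rw [div_add' _ _ _ (by positivity), le_div_iff₀ (by positivity)]
      nlinarith [sq_nonneg (√l - 9 / 20)]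
    have h4 : 0 ≤ √l * l := by positivity
    linarith
  set B := 3 + √(Real.pi / Real.exp 1) + 2 / (√Real.pi * l ^ (1 / 4 : ℝ)) + 7 / (16 * √l)
      + √l * (2 + l) with hBdef
  have hpi : √Real.pi ≤ 1.775 := by
    rw [Real.sqrt_le_left (by norm_num)]
    have := Real.pi_lt_d2; norm_num at this ⊢; linarith
  -- Up to rounding of `2√3`, this is the tangent to the square root at `3`.
  have hsy : √y ≤ (y + 3) / 3.46 := by
    rw [Real.sqrt_le_left (by positivity), div_pow, le_div_iff₀ (by norm_num)]
    nlinarith [sq_nonneg (y - 3)]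
  have hsy0 : 0 < √y := Real.sqrt_pos.2 (by linarith)
  -- From `λ ≤ y/2.2`, the exponent is at least `0.86 y = 2.58 + 0.86 (y - 3)`, and `e^2.58 ≥ 12.5`.
  have hexp : 12.5 * (1 + 0.86 * (y - 3)) ≤ Real.exp (2 * y - 2.5 * l) := by
    have e1 : Real.exp 2 = Real.exp 1 * Real.exp 1 := by rw [← Real.exp_add]; norm_num
    have e2 := Real.exp_one_gt_d9
    have e3 : 7.38 ≤ Real.exp 2 := by rw [e1]; nlinarith
    have e4 := Real.quadratic_le_exp_of_nonneg (x := 0.58) (by norm_num)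
    have e5 := Real.add_one_le_exp (0.86 * (y - 3))
    have e6 : 12.5 ≤ Real.exp 2 * Real.exp 0.58 := by
      calc (12.5 : ℝ) ≤ 7.38 * (1 + 0.58 + 0.58 ^ 2 / 2) := by norm_num
        _ ≤ _ := by gcongr
    calc 12.5 * (1 + 0.86 * (y - 3)) ≤ (Real.exp 2 * Real.exp 0.58) * Real.exp (0.86 * (y - 3)) := by
          refine mul_le_mul e6 (by linarith) (by linarith) (by positivity)
      _ = Real.exp (2 + 0.58 + 0.86 * (y - 3)) := by rw [Real.exp_add, Real.exp_add]
      _ ≤ _ := by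
          rw [Real.exp_le_exp]; linarith
  have hmain : 41 * (2 * √Real.pi * √y) ≤ 4 * (29 / 5) * Real.exp (2 * y - 2.5 * l) := by
    have h1 : √Real.pi * √y ≤ 1.775 * ((y + 3) / 3.46) := by gcongr
    generalize Real.exp (2 * y - 2.5 * l) = E at hexp ⊢
    have h2 : 41 * (2 * √Real.pi * √y) = 82 * (√Real.pi * √y) := by ring
    rw [h2]
    norm_num at h1 hexp ⊢
    linarith
  have hrew : cL l * (n : ℝ) ^ (-(1 / 4) : ℝ) * Real.exp (2 * y) =
      Real.exp (-(3 / 2) * l + 2 * √l) * B * Real.exp (2 * y) / (2 * √Real.pi * √y) := by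
    rw [cL, ← hBdef, Real.rpow_neg hn'.le, ← hroot]
    have : 0 < √Real.pi := Real.sqrt_pos.2 Real.pi_pos
    have : 0 < (n : ℝ) ^ (1 / 4 : ℝ) := by positivity
    field_simp
  have hden : 0 < 2 * √Real.pi * √y := by
    have : 0 < √Real.pi := Real.sqrt_pos.2 Real.pi_pos
    positivity
  rw [hrew, ← mul_div_assoc, le_div_iff₀ hden]
  calc 41 * Real.exp l * (2 * √Real.pi * √y)
      = Real.exp l * (41 * (2 * √Real.pi * √y)) := by ring
    _ ≤ Real.exp l * (4 * (29 / 5) * Real.exp (2 * y - 2.5 * l)) := by gcongr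
    _ = 4 * (Real.exp (-(3 / 2) * l) * (29 / 5) * Real.exp (2 * y)) := by
        have : Real.exp l * Real.exp (2 * y - 2.5 * l) =
            Real.exp (-(3 / 2) * l) * Real.exp (2 * y) := by
          rw [← Real.exp_add, ← Real.exp_add]; congr 1; ring
        linear_combination 4 * (29 / 5) * this
    _ ≤ 4 * (Real.exp (-(3 / 2) * l + 2 * √l) * B * Real.exp (2 * y)) := by
        gcongr
        linarith

end PowerSeriesKernel

end

/-! ### Assembling the two error bounds -/

noncomputable section

namespace PowerSeriesKernel

lemma phiMin_le (φ : Interval → ℝ) (x : Interval) : phiMin φ ≤ |φ x| :=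
  ciInf_le ⟨0, by rintro _ ⟨y, rfl⟩; exact abs_nonneg _⟩ x

lemma le_phiMax {φ : Interval → ℝ} (h : BddAbove (Set.range fun x => |φ x|)) (x : Interval) :
    |φ x| ≤ phiMax φ := le_ciSup h x

lemma lebesgue_univ : lebesgue Set.univ = 2 := by
  rw [lebesgue, comap_subtype_coe_apply measurableSet_Icc, Set.image_univ, Subtype.range_coe,
    Real.volume_Icc]
  norm_num

instance : IsFiniteMeasure lebesgue := ⟨by rw [lebesgue_univ]; exact ENNReal.ofNat_lt_top⟩

open Polynomial in
lemma eLpNorm_polynomial (p : ℝ[X]) :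
    eLpNorm (fun x : Interval => p.eval (x : ℝ)) 2 lebesgue =
      ENNReal.ofReal (√(∫ x in (-1 : ℝ)..1, p.eval x ^ 2)) := by
  have hcont : Continuous fun x : Interval => p.eval (x : ℝ) := by fun_prop
  have hmem : MemLp (fun x : Interval => p.eval (x : ℝ)) 2 lebesgue := by
    obtain ⟨C, hC⟩ := (isCompact_range hcont).isBounded.exists_norm_le
    exact MemLp.of_bound hcont.aestronglyMeasurable C
      (Filter.Eventually.of_forall fun x => hC _ ⟨x, rfl⟩)
  rw [hmem.eLpNorm_eq_integral_rpow_norm (by norm_num) (by norm_num)]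
  congr 1
  have h : ∫ x : Interval, p.eval (x : ℝ) ^ 2 ∂lebesgue = ∫ x in (-1 : ℝ)..1, p.eval x ^ 2 := by
    rw [intervalIntegral.integral_of_le (by norm_num), ← integral_Icc_eq_integral_Ioc]
    exact integral_subtype_comap measurableSet_Icc fun x : ℝ => p.eval x ^ 2
  rw [← h, Real.sqrt_eq_rpow]
  simp

variable {φ : Interval → ℝ} {α : ℕ → ℝ} {l : ℝ}
  {H : Type*} [NormedAddCommGroup H] [InnerProductSpace ℝ H] [CompleteSpace H]
  [RKHS ℝ H Interval ℝ] {n : ℕ}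

lemma rpow_neg_half_sq {a : ℝ} (ha : 0 < a) : (a ^ (-(1 / 2) : ℝ)) ^ 2 = a⁻¹ := by
  rw [← Real.rpow_natCast, ← Real.rpow_mul ha.le, ← Real.rpow_neg_one]
  norm_num

lemma two_rpow_neg_sq (n : ℕ) : ((2 : ℝ) ^ (-(n : ℝ))) ^ 2 = (1 / 4) ^ n := by
  rw [Real.rpow_neg (by norm_num), Real.rpow_natCast, inv_pow, ← pow_mul, mul_comm n, pow_mul, one_div, inv_pow]
  norm_num

open Polynomial in
/-- A function in the space that vanishes at the given points and has a large `L²` norm. -/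
lemma exists_fooling_function (hφ_inf : 0 < phiMin φ) (hα_pos : ∀ k, 0 < α k)
    (hα_sum : Summable fun k => (α k)⁻¹) (hl : 0 < l)
    (hα : ∀ n k : ℕ, k ≤ n →
      α k / α n ≤ l ^ (n - k) * ((k.factorial : ℝ) / (n.factorial : ℝ)))
    (hH : IsRKHSOf H (kernel φ α)) (hn : 5 * l ≤ n) (pt : Fin n → Interval) :
    ∃ f : H, f ≠ 0 ∧ (∀ j, f (pt j) = 0) ∧
      ENNReal.ofReal (cLower l φ * (2 : ℝ) ^ (-(n : ℝ)) * α n ^ (-(1 / 2) : ℝ)) * ‖f‖ₑ ≤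
        eLpNorm (fun x => f x) 2 lebesgue := by
  set p : ℝ[X] := Lagrange.nodal Finset.univ fun j => (pt j : ℝ) with hp
  have hdeg : p.natDegree = n := by rw [hp, Lagrange.natDegree_nodal]; simp
  have hmonic : p.Monic := Lagrange.nodal_monic
  obtain ⟨f, hf, hfn⟩ := exists_eq_polynomial hα_pos hα_sum hH p
  set I := ∫ x in (-1 : ℝ)..1, p.eval x ^ 2 with hI
  have hsum := sum_mul_sq_coeff_le_integral hα_pos hα (n := n) hdeg.le
  rw [hdeg] at hfn
  have hpi := Real.pi_pos
  have hαn := hα_pos n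
  have hI0 : 0 ≤ I := intervalIntegral.integral_nonneg (by norm_num) fun x _ => sq_nonneg _
  have hbound := hsum.trans (mul_le_mul_of_nonneg_left
    (mul_le_mul_of_nonneg_left (sum_four_pow_mul_le hα_pos hl hα hn) (Real.exp_pos _).le)
    (by positivity))
  -- If `I` were zero, the coefficient bound would force the leading term `αₙ · 1` of the monic `p`
  -- to vanish.
  have hpos : 0 < I := by
    refine lt_of_le_of_ne hI0 fun h => ?_
    rw [← hI, ← h, mul_zero, zero_mul] at hbound
    have h1 : α n * p.coeff n ^ 2 ≤ ∑ k ∈ Finset.range (n + 1), α k * p.coeff k ^ 2 :=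
      Finset.single_le_sum (f := fun k => α k * p.coeff k ^ 2)
        (fun k _ => mul_nonneg (hα_pos k).le (sq_nonneg _)) (by simp)
    have h2 : p.coeff n = 1 := by rw [← hdeg]; exact hmonic
    rw [h2] at h1
    linarith
  have hnorm : ENNReal.ofReal (phiMin φ * √I) ≤ eLpNorm (fun x => f x) 2 lebesgue := by
    calc ENNReal.ofReal (phiMin φ * √I)
        = ‖phiMin φ‖ₑ * eLpNorm (fun x : Interval => p.eval (x : ℝ)) 2 lebesgue := by
          rw [eLpNorm_polynomial, ENNReal.ofReal_mul hφ_inf.le, Real.enorm_of_nonneg hφ_inf.le]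
      _ = eLpNorm (phiMin φ • fun x : Interval => p.eval (x : ℝ)) 2 lebesgue :=
          (eLpNorm_const_smul _ _ _ _).symm
      _ ≤ eLpNorm (fun x => f x) 2 lebesgue := by
          refine eLpNorm_mono fun x => ?_
          rw [hf, Pi.smul_apply, smul_eq_mul, norm_mul, norm_mul, Real.norm_of_nonneg hφ_inf.le]
          gcongr
          exact phiMin_le φ x
  refine ⟨f, ?_, fun j => ?_, ?_⟩
  · rintro rfl
    have h0 : eLpNorm (fun x => (0 : H) x) 2 lebesgue = 0 := by
      simp
    rw [h0, nonpos_iff_eq_zero, ENNReal.ofReal_eq_zero] at hnorm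
    have : 0 < phiMin φ * √I := mul_pos hφ_inf (Real.sqrt_pos.2 hpos)
    linarith
  · rw [hf, hp, Lagrange.eval_nodal_at_node (v := fun j => (pt j : ℝ)) (Finset.mem_univ j), mul_zero]
  · refine le_trans ?_ hnorm
    rw [← ofReal_norm, ← ENNReal.ofReal_mul' (norm_nonneg _)]
    refine ENNReal.ofReal_le_ofReal (le_of_sq_le_sq ?_ (by positivity))
    have hc : cLower l φ ^ 2 = 8 * Real.pi / (9 * Real.exp 6 * (4 + l)) *
        (Real.exp (l ^ 2 / 16))⁻¹ * phiMin φ ^ 2 := by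
      have e1 : Real.exp (-(1 / 32) * l ^ 2) ^ 2 = (Real.exp (l ^ 2 / 16))⁻¹ := by
        rw [← Real.exp_nat_mul, ← Real.exp_neg]; congr 1; push_cast; ring
      have e2 : Real.exp 3 ^ 2 = Real.exp 6 := by
        rw [← Real.exp_nat_mul]; norm_num
      rw [cLower, mul_pow, mul_pow, e1, div_pow, mul_pow, mul_pow, mul_pow, e2,
        Real.sq_sqrt (by positivity), Real.sq_sqrt (by positivity)]
      congr 3 <;> ring
    rw [mul_pow, mul_pow, mul_pow, mul_pow, Real.sq_sqrt hI0, rpow_neg_half_sq hαn,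
      two_rpow_neg_sq, hc]
    have hf2 := hfn.trans hbound
    calc 8 * Real.pi / (9 * Real.exp 6 * (4 + l)) * (Real.exp (l ^ 2 / 16))⁻¹ * phiMin φ ^ 2 *
          (1 / 4) ^ n * (α n)⁻¹ * ‖f‖ ^ 2
        ≤ 8 * Real.pi / (9 * Real.exp 6 * (4 + l)) * (Real.exp (l ^ 2 / 16))⁻¹ * phiMin φ ^ 2 *
          (1 / 4) ^ n * (α n)⁻¹ *
            (2 / Real.pi * I * (Real.exp (l ^ 2 / 16) * (2 * (4 ^ n * α n)))) := by gcongr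
      _ = 32 / (9 * Real.exp 6 * (4 + l)) * (phiMin φ ^ 2 * I) := by
          rw [div_pow, one_pow]; field_simp; norm_num
      _ ≤ 1 * (phiMin φ ^ 2 * I) := by
          gcongr
          rw [div_le_one (by positivity)]
          have : 1 ≤ Real.exp 6 := Real.one_le_exp (by norm_num)
          nlinarith
      _ = _ := one_mul _

lemma minimalError_ge (hφ_inf : 0 < phiMin φ) (hα_pos : ∀ k, 0 < α k)
    (hα_sum : Summable fun k => (α k)⁻¹) (hl : 0 < l)
    (hα : ∀ n k : ℕ, k ≤ n →
      α k / α n ≤ l ^ (n - k) * ((k.factorial : ℝ) / (n.factorial : ℝ)))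
    (hH : IsRKHSOf H (kernel φ α)) (hn : 5 * l ≤ n) :
    ENNReal.ofReal (cLower l φ * (2 : ℝ) ^ (-(n : ℝ)) * α n ^ (-(1 / 2) : ℝ)) ≤
      minimalError H n := by
  refine le_iInf fun A => ?_
  obtain ⟨f, hf0, hf, hle⟩ := exists_fooling_function hφ_inf hα_pos hα_sum hl hα hH hn A.point
  refine le_trans ?_ (le_iSup₂ (f := fun (f : H) (_ : f ≠ 0) =>
    eLpNorm (fun x => f x - A.apply f x) 2 lebesgue / ‖f‖ₑ) f hf0)
  rw [ENNReal.le_div_iff_mul_le (Or.inl (by simpa using hf0)) (Or.inl enorm_ne_top)]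
  simpa [LinearApprox.apply, hf] using hle

/-- Weighted interpolation at the Chebyshev nodes. -/
def chebyshevApprox (hφ : NullMeasurable φ lebesgue) (n : ℕ) : LinearApprox n where
  point j := ⟨chebyshevNode n j, chebyshevNode_mem n j⟩
  point_injective _ _ h := chebyshevNode_injective n (congrArg Subtype.val h)
  weight j x := φ x / φ ⟨chebyshevNode n j, chebyshevNode_mem n j⟩ *
    (Lagrange.basis Finset.univ (chebyshevNode n) j).eval (x : ℝ)
  weight_measurable j := by
    have h1 : AEMeasurable φ lebesgue := hφ.aemeasurable
    have h2 : Continuous fun x : Interval =>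
      (Lagrange.basis Finset.univ (chebyshevNode n) j).eval (x : ℝ) := by fun_prop
    exact ((h1.div_const _).mul h2.measurable.aemeasurable).nullMeasurable

/-- The quotient `φ(x)/φ(xⱼ)` in the weights turns the error for `φ·xᵏ` into `φ(x)` times the
polynomial interpolation error of `xᵏ`. -/
lemma abs_sub_chebyshevApprox_le (hφ : NullMeasurable φ lebesgue) (hφ_inf : 0 < phiMin φ)
    (hφ_sup : BddAbove (Set.range fun x => |φ x|)) (hα_pos : ∀ k, 0 < α k)
    (hα_sum : Summable fun k => (α k)⁻¹) (hl : 0 < l)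
    (hα : ∀ n k : ℕ, k ≤ n →
      α k / α n ≤ l ^ (n - k) * ((k.factorial : ℝ) / (n.factorial : ℝ)))
    (hH : IsRKHSOf H (kernel φ α)) (hn0 : 0 < n) (hn : 5 * l ≤ n) (f : H) (x : Interval) :
    (f x - (chebyshevApprox hφ n).apply f x) ^ 2 ≤
      ‖f‖ ^ 2 * (phiMax φ ^ 2 * ((α n)⁻¹ * (1 / 4) ^ n * (41 * Real.exp l))) := by
  set A := chebyshevApprox hφ n with hA
  refine (sq_apply_sub_sum_le hα_pos hα_sum hH A.point (fun j => A.weight j x) x f).trans ?_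
  gcongr
  have hterm : ∀ k : ℕ, (α k)⁻¹ * (φ x * (x : ℝ) ^ k -
      ∑ j, A.weight j x * (φ (A.point j) * (A.point j : ℝ) ^ k)) ^ 2 =
      φ x ^ 2 * ((α k)⁻¹ * interpError n x (Polynomial.X ^ k) ^ 2) := by
    intro k
    have : φ x * (x : ℝ) ^ k - ∑ j, A.weight j x * (φ (A.point j) * (A.point j : ℝ) ^ k) =
        φ x * interpError n x (Polynomial.X ^ k) := by
      rw [interpError, mul_sub, Finset.mul_sum]
      congr 1
      · simp
      · refine Finset.sum_congr rfl fun j _ => ?_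
        have hne : φ ⟨chebyshevNode n j, chebyshevNode_mem n j⟩ ≠ 0 := by
          rw [← abs_pos]; exact hφ_inf.trans_le (phiMin_le φ _)
        simp only [hA, chebyshevApprox, Polynomial.eval_pow, Polynomial.eval_X]
        field_simp
    rw [this]; ring
  simp_rw [hterm]
  rw [tsum_mul_left]
  have h1 : φ x ^ 2 ≤ phiMax φ ^ 2 := by
    rw [← sq_abs (φ x)]
    have := le_phiMax hφ_sup x
    gcongr
  have h2 := tsum_sq_interpError_le hα_pos hl hα hn0 hn x.2
  exact mul_le_mul h1 h2
    (tsum_nonneg fun k => mul_nonneg (inv_pos.2 (hα_pos k)).le (sq_nonneg _)) (sq_nonneg _)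

lemma minimalError_le (hφ : NullMeasurable φ lebesgue) (hφ_inf : 0 < phiMin φ)
    (hφ_sup : BddAbove (Set.range fun x => |φ x|)) (hα_pos : ∀ k, 0 < α k)
    (hα_sum : Summable fun k => (α k)⁻¹) (hl : 0 < l)
    (hα : ∀ n k : ℕ, k ≤ n →
      α k / α n ≤ l ^ (n - k) * ((k.factorial : ℝ) / (n.factorial : ℝ)))
    (hH : IsRKHSOf H (kernel φ α)) (hn : mL l ≤ n) :
    minimalError H n ≤
      ENNReal.ofReal (cUpper l φ * (n : ℝ) ^ (-(1 / 8) : ℝ) *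
        Real.exp (√(l * n)) * (2 : ℝ) ^ (-(n : ℝ)) * α n ^ (-(1 / 2) : ℝ)) := by
  have h5 : 5 * l ≤ n := (le_max_left _ _).trans hn
  have hn' : (0 : ℝ) < n := by linarith
  have hn0 : 0 < n := by exact_mod_cast hn'
  have hαn := hα_pos n
  have hmax : 0 ≤ phiMax φ := (abs_nonneg _).trans (le_phiMax hφ_sup ⟨0, by norm_num⟩)
  have hcL : 0 ≤ cL l := by unfold cL; positivity
  set R := cUpper l φ * (n : ℝ) ^ (-(1 / 8) : ℝ) *
        Real.exp (√(l * n)) * (2 : ℝ) ^ (-(n : ℝ)) * α n ^ (-(1 / 2) : ℝ) with hR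
  have hcU : 0 ≤ cUpper l φ := by unfold cUpper; positivity
  have hR0 : 0 ≤ R := by positivity
  have hRsq : R ^ 2 = 2 * (phiMax φ ^ 2 * ((α n)⁻¹ * (1 / 4) ^ n *
      (4 * (cL l * (n : ℝ) ^ (-(1 / 4) : ℝ) * Real.exp (2 * √(l * n)))))) := by
    have e1 : ((n : ℝ) ^ (-(1 / 8) : ℝ)) ^ 2 = (n : ℝ) ^ (-(1 / 4) : ℝ) := by
      rw [← Real.rpow_natCast, ← Real.rpow_mul hn'.le]; norm_num
    have e2 : Real.exp (√(l * n)) ^ 2 = Real.exp (2 * √(l * n)) := by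
      rw [← Real.exp_nat_mul]; norm_num
    rw [hR, mul_pow, mul_pow, mul_pow, mul_pow, e1, e2, two_rpow_neg_sq, rpow_neg_half_sq hαn,
      cUpper, mul_pow, mul_pow, Real.sq_sqrt (by positivity)]
    ring
  set D := phiMax φ ^ 2 * ((α n)⁻¹ * (1 / 4) ^ n * (41 * Real.exp l)) with hD
  have hD0 : 0 ≤ D := by positivity
  -- `√D` bounds the error uniformly on the unit ball, and `√2` is the square root of the length of
  -- the interval.
  have hDR : √2 * √D ≤ R := by
    refine le_of_sq_le_sq ?_ hR0
    rw [mul_pow, Real.sq_sqrt (by norm_num), Real.sq_sqrt hD0, hRsq, hD]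
    have := exp_mul_le_cL hl hn
    gcongr
  refine (iInf_le _ (chebyshevApprox hφ n)).trans (iSup₂_le fun f hf => ?_)
  refine ENNReal.div_le_of_le_mul ?_
  have hpt : ∀ x, ‖f x - (chebyshevApprox hφ n).apply f x‖ ≤ √D * ‖f‖ := by
    intro x
    refine abs_le_of_sq_le_sq ?_ (by positivity)
    rw [mul_pow, Real.sq_sqrt hD0, mul_comm]
    exact abs_sub_chebyshevApprox_le hφ hφ_inf hφ_sup hα_pos hα_sum hl hα hH hn0 h5 f x
  refine (eLpNorm_le_of_ae_bound (Filter.Eventually.of_forall hpt)).trans ?_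
  rw [lebesgue_univ]
  have h2 : (2 : ℝ≥0∞) ^ ((2 : ℝ≥0∞).toReal⁻¹) = ENNReal.ofReal (√2) := by
    rw [Real.sqrt_eq_rpow, ← ENNReal.ofReal_rpow_of_pos (by norm_num)]
    norm_num
  rw [h2, ← ofReal_norm, ← ENNReal.ofReal_mul (Real.sqrt_nonneg _),
    ← ENNReal.ofReal_mul hR0, ← mul_assoc]
  exact ENNReal.ofReal_le_ofReal (by gcongr)

end PowerSeriesKernel

end

theorem theorem4p4
    (φ : PowerSeriesKernel.Interval → ℝ) (hφ_meas : NullMeasurable φ PowerSeriesKernel.lebesgue)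
    (hφ_inf : 0 < PowerSeriesKernel.phiMin φ) (hφ_sup : BddAbove (Set.range fun x => |φ x|))
    (α : ℕ → ℝ) (hα_pos : ∀ k, 0 < α k) (hα_sum : Summable fun k => (α k)⁻¹)
    (l : ℝ) (hl : 0 < l)
    (hα : ∀ n k : ℕ, k ≤ n →
      α k / α n ≤ l ^ (n - k) * ((k.factorial : ℝ) / (n.factorial : ℝ)))
    {H : Type*} [NormedAddCommGroup H] [InnerProductSpace ℝ H] [CompleteSpace H]
    [RKHS ℝ H PowerSeriesKernel.Interval ℝ]
    (hH : PowerSeriesKernel.IsRKHSOf H (PowerSeriesKernel.kernel φ α))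
    (n : ℕ) (hn : PowerSeriesKernel.mL l ≤ (n : ℝ)) :
    ENNReal.ofReal (PowerSeriesKernel.cLower l φ * (2 : ℝ) ^ (-(n : ℝ)) * α n ^ (-(1 / 2) : ℝ))
        ≤ PowerSeriesKernel.minimalError H n ∧
      PowerSeriesKernel.minimalError H n ≤
        ENNReal.ofReal (PowerSeriesKernel.cUpper l φ * (n : ℝ) ^ (-(1 / 8) : ℝ) *
          Real.exp (√(l * n)) * (2 : ℝ) ^ (-(n : ℝ)) * α n ^ (-(1 / 2) : ℝ)) := by
  have h5 : 5 * l ≤ n := (le_max_left _ _).trans hn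
  exact ⟨PowerSeriesKernel.minimalError_ge hφ_inf hα_pos hα_sum hl hα hH h5,
    PowerSeriesKernel.minimalError_le hφ_meas hφ_inf hφ_sup hα_pos hα_sum hl hα hH hn⟩
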